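/- **Models.** Let $G=(V,E)$ be a finite undirected graph without loops on $n$ processes, and let $N_i$ be the set of neighbors of $P_i$. In an *R(1)W(1) algorithm* $A$ each process $P_i$ has a local state $x_i$ and a set of guarded commands. A guard is a predicate on the local states of $P_i$ and of the processes in $N_i$. A command reads these local states and assigns new values to them. A process is enabled if one of its guards is true. Under the *unfair central daemon*, in each move an arbitrarily (adversarially) chosen single enabled process executes one command whose guard is true; an execution continues as long as some process is enabled. $A$ is *self-stabilizing* with respect to a set $\Lambda$ of (legitimate) configurations if $\Lambda$ is closed under moves and every execution from every configuration reaches $\Lambda$. It is *silent* if no process is enabled in a configuration of $\Lambda$. It *stabilizes in $T_A$ moves* if every execution from every configuration reaches $\Lambda$ after at most $T_A$ moves. In the *synchronous message-passing model with synchronized clocks*, in each round each process broadcasts at most one message to its neighbors, receives all messages of its neighbors (communication is reliable), and updates its local variables, possibly using fresh independent random numbers; all processes share the clock value. **The transformation TrR1W1.** Let $n'\ge n$ and $K\ge 2$ be integers and $R=Kn'$. In the transformed algorithm $A'$, process $\mathcal P_i$ has the simulated state $x_i$, a cache $C_i[j]$ of $x_j$ for each $j\in N_i$, a number $r_i$,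 a flag $g_i$, a winner candidate $w_i\in V\cup\{\bot\}$, and two flags that record "a command was executed in Phase 3" and "$x_i$ was updated in Phase 4". It repeats a cycle of five phases, each of which is one round: 1. Broadcast $x_i$; update the cache from the received messages; set $g_i$ to true iff some guard of $P_i$ is true when evaluated on $x_i$ and $C_i$; if $g_i$, draw $r_i$ uniformly from $\{1,\dots,R\}$. 2. If $g_i$, broadcast $r_i$. Among the votes received from neighbors, together with the own vote $r_i$ if $g_i$: if the maximum is attained by exactly one process, let $w_i$ be that process; otherwise, or if there is no vote, $w_i:=\bot$. 3. If $w_i\ne\bot$, broadcast $w_i$; if moreover every neighbor sent the message "$i$" and some guard of $P_i$ is true on $x_i, C_i$, execute one command whose guard is true (selected by any fixed local rule) on $x_i, C_i$. 4. If a command was executed in Phase 3, broadcast $x_i, C_i$. On receiving $x_j, C_j$ from a neighbor $j$, set $C_i[j]:=x_j$ and $x_i:=C_j[i]$ (if there are several such neighbors, the value of any one of them is taken for $x_i$). 5. If $x_i$ was updated in Phase 4, broadcast $x_i$. Update the cache from the received messages. Let $\Lambda'$ be the set of configurations of $A'$ in which $(x_i)_i\in\Lambda$, the cache is coherent ($C_i[j]=x_j$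 for all $i$ and all $j\in N_i$), and nothing is pending ($g_i$ and both flags are false and $w_i=\bot$ for all $i$); the clock value is arbitrary. **Theorem.** There is an absolute constant $\kappa$ such that the following holds for every $G$, every $A$ and $\Lambda$, every $T_A\in\mathbb N$, and all $n'\ge n$ and $K\ge2$. If $A$ is a silent self-stabilizing R(1)W(1) algorithm with respect to $\Lambda$ that stabilizes in $T_A$ moves under the unfair central daemon, then $A'$ is self-stabilizing with respect to $\Lambda'$ in the synchronous message-passing model: $\Lambda'$ is closed under rounds (for all random choices), and from every initial configuration (arbitrary local variables, arbitrary phase) $\Lambda'$ is reached with probability $1$. Moreover, from every initial configuration the expected number of rounds until $\Lambda'$ is reached is at most $\kappa\max\{T_A,1\}$, that is, $O(T_A)$ whenever $T_A\ge1$. -/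

import Mathlib

/-- A copy of the local state of process `i` and of the local states of its neighbors: what a
single move of `i` reads, and also what it writes. -/
structure NbhdView {V : Type} (G : SimpleGraph V) (Q : V → Type) (i : V) where
  own : Q i
  nbr : ∀ j : V, G.Adj i j → Q j

/-- A distributed algorithm in the R(1)W(1) model on the communication graph `G`, given by guarded
commands. A guard of process `i` reads the local states of `i` and of its neighbors; the
command computes new values for the local states of `i` and of its neighbors. -/
structure R1W1Alg {V : Type} (G : SimpleGraph V) where
  /-- local states of each process -/
  Q : V → Type
  /-- names of the guarded commands of each process -/
  Rule : V → Type
  guard : ∀ i : V, Rule i → NbhdView G Q i → Prop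
  command : ∀ i : V, Rule i → NbhdView G Q i → NbhdView G Q i

namespace R1W1Alg

variable {V : Type} {G : SimpleGraph V} (A : R1W1Alg G)

/-- Configurations: tuples of local states. -/
abbrev Config : Type := ∀ i : V, A.Q i

/-- What process `i` reads in configuration `γ`. -/
def view (γ : A.Config) (i : V) : NbhdView G A.Q i := ⟨γ i, fun j _ => γ j⟩

open Classical in
/-- The configuration after process `i` has written `v` to its own local state and to those of
its neighbors. -/
noncomputable def write (γ : A.Config) (i : V) (v : NbhdView G A.Q i) : A.Config := fun j =>
  if h : i = j then h ▸ v.own else if h : G.Adj i j then v.nbr j h else γ j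

/-- Some guard of process `i` is true when it reads `v`. -/
def EnabledAt (i : V) (v : NbhdView G A.Q i) : Prop := ∃ ρ : A.Rule i, A.guard i ρ v

/-- Process `i` is enabled in configuration `γ`. -/
def Enabled (γ : A.Config) (i : V) : Prop := A.EnabledAt i (A.view γ i)

/-- `γ → γ'`: under the central daemon, exactly one enabled process executes one command whose
guard is true. -/
def Step (γ γ' : A.Config) : Prop :=
  ∃ (i : V) (ρ : A.Rule i), A.guard i ρ (A.view γ i) ∧
    γ' = A.write γ i (A.command i ρ (A.view γ i))

/-- Maximal executions under the unfair central daemon, i.e. with an arbitrary serial schedule.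
An execution continues as long as some process is enabled; a finite maximal execution is extended
to an infinite sequence by repeating its last configuration. Thus `e t` is the configuration
after `t` moves, or the last one if there are fewer moves. -/
def IsExecution (e : ℕ → A.Config) : Prop :=
  ∀ t, A.Step (e t) (e (t + 1)) ∨ ((∀ i, ¬ A.Enabled (e t) i) ∧ e (t + 1) = e t)

/-- Self-stabilization with respect to the set `L` of legitimate configurations: closure and
convergence. -/
def SelfStabilizing (L : Set A.Config) : Prop :=
  (∀ γ ∈ L, ∀ γ', A.Step γ γ' → γ' ∈ L) ∧
  (∀ e, A.IsExecution e → ∃ t, e t ∈ L)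

/-- `A` is silent: no process takes any action when the system is stabilized. -/
def Silent (L : Set A.Config) : Prop := ∀ γ ∈ L, ∀ i, ¬ A.Enabled γ i

/-- In the worst case (every initial configuration, every unfair central daemon) a legitimate
configuration is reached after at most `T` moves. -/
def StabilizesInMoves (L : Set A.Config) (T : ℕ) : Prop :=
  ∀ e, A.IsExecution e → ∃ t ≤ T, e t ∈ L

/-- A local choice of the command to be executed by an enabled process, among those whose guards
are true. -/
def Selector : Type :=
  ∀ (i : V) (v : NbhdView G A.Q i), A.EnabledAt i v → {ρ : A.Rule i // A.guard i ρ v}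

end R1W1Alg

/-- A randomized algorithm in the synchronous message-passing model on the graph `G`, where all
processes have access to a common synchronized clock. In each round, each process broadcasts at
most one message to all its neighbors (`none`: no message), receives all messages of its neighbors,
and updates its local variables, possibly using a random number uniform on a range of size
`coinRange` (independent between processes and rounds). Communication is reliable. -/
structure SyncMPAlg {V : Type} (G : SimpleGraph V) where
  /-- values of the synchronized clock -/
  Clock : Type
  tick : Clock → Clock
  /-- local states of each process -/
  Loc : V → Type
  /-- messages that each process may send -/
  Msg : V → Type
  coinRange : ℕ
  coinRange_neZero : NeZero coinRange
  bcast : Clock → ∀ i : V, Loc i → Option (Msg i)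
  update : Clock → ∀ i : V, Loc i → (∀ j : V, G.Adj i j → Option (Msg j)) →
    Fin coinRange → Loc i

namespace SyncMPAlg

variable {V : Type} {G : SimpleGraph V} (B : SyncMPAlg G)

/-- A configuration: the common clock value and all local states. -/
@[ext] structure Config where
  clock : B.Clock
  loc : ∀ i : V, B.Loc i

/-- One synchronous round, where `a i` is the random number drawn by process `i`. -/
def round (c : B.Config) (a : V → Fin B.coinRange) : B.Config where
  clock := B.tick c.clock
  loc i := B.update c.clock i (c.loc i) (fun j _ => B.bcast c.clock j (c.loc j)) (a i)

/-- The random numbers of all rounds and all processes. -/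
abbrev Coins : Type := ℕ × V → Fin B.coinRange

/-- All random numbers are independent and uniform. -/
noncomputable def coinMeasure : MeasureTheory.Measure B.Coins :=
  haveI := B.coinRange_neZero
  MeasureTheory.Measure.infinitePi
    (fun _ : ℕ × V => (PMF.uniformOfFintype (Fin B.coinRange)).toMeasure)

/-- The configuration after `t` rounds from the initial configuration `c`. -/
def run (c : B.Config) (ω : B.Coins) : ℕ → B.Config
  | 0 => c
  | t + 1 => B.round (run c ω t) (fun i => ω (t, i))

/-- The number of rounds until a configuration in `L` is reached (`∞` if this never happens). -/
noncomputable def stabilizationTime (L : Set B.Config) (c : B.Config) (ω : B.Coins) : ENNReal :=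
  ⨅ (t : ℕ) (_ : B.run c ω t ∈ L), (t : ENNReal)

/-- Self-stabilization with respect to the set `L` of legitimate configurations: closure
(whatever random numbers are drawn), and convergence with probability one from every initial
configuration. -/
def SelfStabilizing (L : Set B.Config) : Prop :=
  (∀ c ∈ L, ∀ a, B.round c a ∈ L) ∧
  (∀ c, ∀ᵐ ω ∂B.coinMeasure, ∃ t, B.run c ω t ∈ L)

/-- The expected number of rounds until a legitimate configuration is reached, from a given
initial configuration. -/
noncomputable def expectedRounds (L : Set B.Config) (c : B.Config) : ENNReal :=
  ∫⁻ ω, B.stabilizationTime L c ω ∂B.coinMeasure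

end SyncMPAlg

namespace TrR1W1

/-- The five phases of a cycle. -/
inductive Phase : Type
  | p1 | p2 | p3 | p4 | p5

/-- Successor phase; a new cycle starts after the fifth phase. -/
def Phase.next : Phase → Phase
  | p1 => p2
  | p2 => p3
  | p3 => p4
  | p4 => p5
  | p5 => p1

/-- Local variables of process `i` in the transformed algorithm. -/
structure Loc {V : Type} (G : SimpleGraph V) (Q : V → Type) (i : V) where
  /-- simulated local state -/
  x : Q i
  /-- cache of the simulated local states of the neighbors -/
  C : ∀ j : V, G.Adj i j → Q j
  /-- random vote -/
  r : ℕ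
  /-- whether there is a true guard -/
  g : Bool
  /-- winner candidate (`none` is `⊥`) -/
  w : Option V
  /-- whether a command was executed in Phase 3 -/
  executed : Bool
  /-- whether `x` was updated by a neighbor in Phase 4 -/
  updated : Bool

/-- Messages that process `j` may broadcast. -/
inductive Msg {V : Type} (G : SimpleGraph V) (Q : V → Type) (j : V) : Type
  /-- the value `x_j` (Phases 1 and 5) -/
  | state (y : Q j)
  /-- the vote `r_j` (Phase 2) -/
  | vote (r : ℕ)
  /-- the winner candidate `w_j` (Phase 3) -/
  | winner (k : V)
  /-- the values `x_j, C_j` (Phase 4) -/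
  | values (v : NbhdView G Q j)

variable {V : Type} {G : SimpleGraph V} {Q : V → Type}

/-- The simulated states that process `i` sees: its own state and its cache. -/
def Loc.view {i : V} (s : Loc G Q i) : NbhdView G Q i := ⟨s.x, s.C⟩

/-- The messages received by process `i` from its neighbors in one round. -/
abbrev Inbox (G : SimpleGraph V) (Q : V → Type) (i : V) : Type :=
  ∀ j : V, G.Adj i j → Option (Msg G Q j)

/-- The cache `C` updated with the senders' states contained in the received messages. -/
def refresh {i : V} (C : ∀ j : V, G.Adj i j → Q j) (m : Inbox G Q i) :
    ∀ j : V, G.Adj i j → Q j := fun j h =>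
  match m j h with
  | some (.state y) => y
  | some (.values v) => v.own
  | _ => C j h

/-- Process `i` knows the vote `r` of process `j`: it is its own vote, broadcast in this phase, or
it is received from a neighbor. -/
def HasVote {i : V} (s : Loc G Q i) (m : Inbox G Q i) (j : V) (r : ℕ) : Prop :=
  (j = i ∧ s.g = true ∧ r = s.r) ∨ ∃ h : G.Adj i j, m j h = some (.vote r)

/-- `j` is the unique process with the maximum vote among the votes known to process `i`. -/
def IsCandidate {i : V} (s : Loc G Q i) (m : Inbox G Q i) (j : V) : Prop :=
  ∃ r, HasVote s m j r ∧ ∀ k r', HasVote s m k r' → k ≠ j → r' < r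

/-- Process `i` receives the message that its simulated state is set to `y` by a neighbor. -/
def ReceivesWrite {i : V} (m : Inbox G Q i) (y : Q i) : Prop :=
  ∃ (j : V) (h : G.Adj i j) (v : NbhdView G Q j), m j h = some (.values v) ∧ v.nbr i h.symm = y

/-- The message broadcast in each phase, if any. -/
def bcast : Phase → ∀ i : V, Loc G Q i → Option (Msg G Q i)
  | .p1, _, s => some (.state s.x)
  | .p2, _, s => if s.g then some (.vote s.r) else none
  | .p3, _, s => s.w.map .winner
  | .p4, _, s => if s.executed then some (.values s.view) else none
  | .p5, _, s => if s.updated then some (.state s.x) else none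

open Classical in
/-- The local computation of process `i` in each phase, after receiving the messages `m`. Here
`a` is the random number drawn in this round; the random vote is `a + 1`, uniform in
`{1, …, R}`. -/
noncomputable def update (A : R1W1Alg G) (sel : A.Selector) (R : ℕ) :
    Phase → ∀ i : V, Loc G A.Q i → Inbox G A.Q i → Fin R → Loc G A.Q i
  -- Cache refresh and evaluation of guards
  | .p1, i, s, m, a =>
      let C' := refresh s.C m
      let enabled : Prop := A.EnabledAt i ⟨s.x, C'⟩
      { s with C := C', g := decide enabled, r := if enabled then (a : ℕ) + 1 else s.r }
  -- Voting by random numbers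
  | .p2, _, s, m, _ =>
      { s with w := if h : ∃ j, IsCandidate s m j then some h.choose else none }
  -- The winner executes a command
  | .p3, i, s, m, _ =>
      if h : (s.w ≠ none ∧ ∀ j h, m j h = some (.winner i)) ∧ A.EnabledAt i s.view then
        let v := A.command i (sel i s.view h.2).1 s.view
        { s with x := v.own, C := v.nbr, executed := true }
      else { s with executed := false }
  -- Value propagation to one-hop neighbors; among several received values, any one is taken
  | .p4, _, s, m, _ =>
      if h : ∃ y, ReceivesWrite m y then
        { s with x := h.choose, C := refresh s.C m, updated := true }
      else { s with C := refresh s.C m, updated := false }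
  -- Value propagation to two-hop neighbors
  | .p5, _, s, m, _ => { s with C := refresh s.C m }

/-- The transformation of the R(1)W(1) algorithm `A` to the synchronous message-passing model, with
random votes in `{1, …, R}`. -/
noncomputable def transform (A : R1W1Alg G) (sel : A.Selector) (R : ℕ) [NeZero R] :
    SyncMPAlg G where
  Clock := Phase
  tick := Phase.next
  Loc := Loc G A.Q
  Msg := Msg G A.Q
  coinRange := R
  coinRange_neZero := inferInstance
  bcast := bcast
  update := update A sel R

/-- The simulated configuration. -/
def simulated (A : R1W1Alg G) (sel : A.Selector) (R : ℕ) [NeZero R]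
    (c : (transform A sel R).Config) : A.Config :=
  fun i => Loc.x (c.loc i)

/-- Cache coherency: each cache entry for a neighbor equals the simulated state of the neighbor. -/
def Coherent (A : R1W1Alg G) (sel : A.Selector) (R : ℕ) [NeZero R]
    (c : (transform A sel R).Config) : Prop :=
  ∀ i j (h : G.Adj i j), Loc.C (c.loc i) j h = Loc.x (c.loc j)

/-- The configurations of the transformed algorithm that correspond to legitimate configurations
of `A`: the simulated configuration is legitimate, the cache is coherent, and there is no
pending vote, winner candidate or value propagation. The clock is arbitrary. -/
def legitimate (A : R1W1Alg G) (L : Set A.Config) (sel : A.Selector) (R : ℕ) [NeZero R] :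
    Set (transform A sel R).Config :=
  {c | simulated A sel R c ∈ L ∧ Coherent A sel R c ∧
    ∀ i, Loc.g (c.loc i) = false ∧ Loc.w (c.loc i) = none ∧
      Loc.executed (c.loc i) = false ∧ Loc.updated (c.loc i) = false}

end TrR1W1

/-! The expected time is bounded by counting cycles, with a bound on the moves that holds on every
path. Phase 1 reads only the states `x` and sends them to all neighbors, so a cycle ignores whatever
caches, flags and votes it inherits. A process executes only if all its neighbors name it as winner.
Executing processes are therefore nonadjacent and share no neighbor, so their simultaneous commands
can be serialized (`steps_of_disjoint_moves`, `steps_propagated`). A cycle with `k` winners thus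
simulates `k` moves of `A`.

Silence turns `T` into a bound on the length of every sequence of moves
(`Steps.le_of_stabilizesInMoves`), so on every path at most `T` cycles contain a move. A cycle that
starts outside `L` has an enabled process, and if the maximum vote is attained once, that process
moves. For a fixed process, being tied for the maximum has at most `1 / R` of the probability of the
illegitimate start (`card_mul_measure_le`). Since `R ≥ 2n`, a union bound shows that at least half
of the probability of an illegitimate start falls on productive cycles. Summing over cycles, the
expected number of illegitimate starts is at most `2T`. No conditional expectations are needed. -/

namespace R1W1Alg
-- Sequences of moves under the central daemon, and serialization
variable {V : Type} {G : SimpleGraph V} {A : R1W1Alg G}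

/-- `A.Steps k γ γ'`: there is a sequence of `k` moves from `γ` to `γ'`. -/
inductive Steps (A : R1W1Alg G) : ℕ → A.Config → A.Config → Prop
  | refl (γ : A.Config) : Steps A 0 γ γ
  | tail {k : ℕ} {γ γ' γ'' : A.Config} : Steps A k γ γ' → A.Step γ' γ'' → Steps A (k + 1) γ γ''

theorem Steps.trans {k l : ℕ} {γ γ' γ'' : A.Config} (h : A.Steps k γ γ') (h' : A.Steps l γ' γ'') :
    A.Steps (k + l) γ γ'' := by
  induction h' with
  | refl => exact h
  | tail _ hs ih => exact (ih h).tail hs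

theorem Step.exists_enabled {γ γ' : A.Config} (h : A.Step γ γ') : ∃ i, A.Enabled γ i := by
  obtain ⟨i, ρ, hg, -⟩ := h
  exact ⟨i, ρ, hg⟩

theorem exists_step_of_enabled {γ : A.Config} {i : V} (h : A.Enabled γ i) : ∃ γ', A.Step γ γ' := by
  obtain ⟨ρ, hg⟩ := h
  exact ⟨_, i, ρ, hg, rfl⟩

/-- Every configuration starts a maximal execution. -/
theorem exists_isExecution (γ : A.Config) : ∃ e, A.IsExecution e ∧ e 0 = γ := by
  have hnext : ∀ δ : A.Config, ∃ δ', A.Step δ δ' ∨ ((∀ i, ¬ A.Enabled δ i) ∧ δ' = δ) := by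
    intro δ
    by_cases h : ∃ i, A.Enabled δ i
    · obtain ⟨i, hi⟩ := h
      obtain ⟨δ', hδ'⟩ := exists_step_of_enabled hi
      exact ⟨δ', Or.inl hδ'⟩
    · exact ⟨δ, Or.inr ⟨not_exists.1 h, rfl⟩⟩
  choose next hn using hnext
  refine ⟨fun t => next^[t] γ, fun t => ?_, rfl⟩
  simpa only [Function.iterate_succ_apply'] using hn (next^[t] γ)

/-- A move followed by a maximal execution is a maximal execution. -/
theorem IsExecution.cons {e : ℕ → A.Config} (he : A.IsExecution e) {γ : A.Config}
    (h : A.Step γ (e 0)) : A.IsExecution (fun t => Nat.casesOn t γ e) := by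
  rintro (_ | t)
  · exact Or.inl h
  · exact he t

/-- A sequence of moves followed by a maximal execution is a maximal execution, all of whose first
moves are proper. -/
theorem Steps.exists_execution {k : ℕ} {γ γ' : A.Config} (h : A.Steps k γ γ') :
    ∀ e, A.IsExecution e → e 0 = γ' →
      ∃ e', A.IsExecution e' ∧ (∀ t < k, A.Step (e' t) (e' (t + 1))) ∧ ∀ t, e' (k + t) = e t := by
  induction h with
  | refl => exact fun e he _ => ⟨e, he, by simp, by simp⟩
  | @tail k γ γ' γ'' _ hs ih =>
    intro e he h0
    subst h0
    obtain ⟨e', he', hk, ht⟩ := ih _ (he.cons hs) rfl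
    refine ⟨e', he', fun t htk => ?_, fun t => ?_⟩
    · rcases Nat.lt_succ_iff_lt_or_eq.1 htk with h | rfl
      · exact hk t h
      · have h1 := ht 0
        have h2 := ht 1
        simp only [Nat.add_zero] at h1
        rw [h1, h2]
        exact hs
    · rw [Nat.add_assoc, Nat.add_comm 1 t]
      exact ht (t + 1)

/-- Extended to a maximal execution, the sequence visits `L` at some time `t ≤ T`. By silence no
move leaves that configuration, so `t` cannot precede the last of the `k` moves. -/
theorem Steps.le_of_stabilizesInMoves {L : Set A.Config} {T : ℕ} (hs : A.Silent L)
    (hT : A.StabilizesInMoves L T) {k : ℕ} {γ γ' : A.Config} (h : A.Steps k γ γ') : k ≤ T := by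
  obtain ⟨e, he, h0⟩ := exists_isExecution γ'
  obtain ⟨e', he', hk, -⟩ := h.exists_execution e he h0
  obtain ⟨t, htT, htL⟩ := hT e' he'
  by_contra! hlt
  obtain ⟨i, hi⟩ := (hk t (htT.trans_lt hlt)).exists_enabled
  exact hs _ htL i hi

/-- If nothing were enabled, the constant sequence at `γ` would be an execution avoiding `L`. -/
theorem exists_enabled_of_notMem {L : Set A.Config} (hA : A.SelfStabilizing L) {γ : A.Config}
    (h : γ ∉ L) : ∃ i, A.Enabled γ i := by
  by_contra! hne
  obtain ⟨t, ht⟩ := hA.2 (fun _ => γ) fun _ => Or.inr ⟨hne, rfl⟩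
  exact h ht

/-- Moves of processes at pairwise distance at least three, all executed on what the processes
read in the same configuration `γ`, can be serialized. -/
theorem steps_of_disjoint_moves [DecidableEq V] {γ : A.Config} (v : ∀ i, NbhdView G A.Q i)
    (E : Finset V) :
    ∀ γ' : A.Config,
      (∀ i ∈ E, ∃ ρ, A.guard i ρ (A.view γ i) ∧ v i = A.command i ρ (A.view γ i)) →
      (∀ i ∈ E, ∀ j ∈ E, i ≠ j → ¬ G.Adj i j ∧ ∀ k, G.Adj i k → ¬ G.Adj j k) →
      (∀ i ∈ E, γ' i = (v i).own ∧ ∀ j (h : G.Adj i j), γ' j = (v i).nbr j h) →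
      (∀ j ∉ E, (∀ i ∈ E, ¬ G.Adj i j) → γ' j = γ j) →
      A.Steps E.card γ γ' := by
  classical
  induction E using Finset.induction_on with
  | empty =>
    intro γ' _ _ _ h
    rw [show γ' = γ from funext fun j => h j (by simp) (by simp)]
    exact Steps.refl γ
  | insert i F hi ih =>
    intro γ' hv hd hw hu
    rw [Finset.card_insert_of_notMem hi]
    -- `γ₀` undoes the move of `i` on its closed neighborhood. The closed neighborhoods of the other
    -- movers are disjoint from it, so their moves lead from `γ` to `γ₀`, where `i` still reads what
    -- it read in `γ`.
    let γ₀ : A.Config := fun j => if j = i ∨ G.Adj i j then γ j else γ' j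
    have hd' : ∀ k ∈ F, k ≠ i ∧ ¬ G.Adj i k ∧ ∀ l, G.Adj i l → ¬ G.Adj k l := by
      intro k hk
      have hki : i ≠ k := fun h => hi (h ▸ hk)
      exact ⟨hki.symm, hd i (by simp) k (by simp [hk]) hki⟩
    have hview : A.view γ₀ i = A.view γ i := by
      have h0 : γ₀ i = γ i := if_pos (Or.inl rfl)
      have h1 : (fun (j : V) (_ : G.Adj i j) => γ₀ j) = fun (j : V) (_ : G.Adj i j) => γ j :=
        funext fun j => funext fun h => if_pos (Or.inr h)
      simp only [view, h0, h1]
    refine (ih γ₀ (fun k hk => hv k (by simp [hk]))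
      (fun k hk l hl => hd k (by simp [hk]) l (by simp [hl])) (fun k hk => ?_) ?_).tail ?_
    · obtain ⟨hki, hik, hl⟩ := hd' k hk
      obtain ⟨h1, h2⟩ := hw k (by simp [hk])
      refine ⟨(if_neg (by tauto)).trans h1, fun j hj => (if_neg ?_).trans (h2 j hj)⟩
      rintro (rfl | hij)
      · exact hik hj.symm
      · exact hl j hij hj
    · intro j hjF hj
      by_cases h : j = i ∨ G.Adj i j
      · exact if_pos h
      · refine (if_neg h).trans (hu j ?_ ?_)
        · simp only [Finset.mem_insert]; tauto
        · intro k hk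
          rcases Finset.mem_insert.1 hk with rfl | hk
          · tauto
          · exact hj k hk
    · obtain ⟨ρ, hg, hρ⟩ := hv i (by simp)
      refine ⟨i, ρ, hview ▸ hg, ?_⟩
      rw [hview, ← hρ]
      obtain ⟨h1, h2⟩ := hw i (by simp)
      funext j
      by_cases hij : i = j
      · subst hij
        simp [write, h1]
      · by_cases hadj : G.Adj i j
        · simp [write, hij, hadj, h2]
        · simp only [write, hij, hadj, dite_false]
          exact (if_neg (by tauto)).symm

end R1W1Alg

/-! ### The phases of a cycle -/

namespace TrR1W1

variable {V : Type} {G : SimpleGraph V} {A : R1W1Alg G}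

/-- The messages received by process `i` when the local variables are `s`. -/
def inbox (ph : Phase) (s : ∀ i, Loc G A.Q i) (i : V) : Inbox G A.Q i :=
  fun j _ => bcast ph j (s j)

/-- The local variables after one round. -/
noncomputable def nextLoc (sel : A.Selector) (R : ℕ) (ph : Phase) (s : ∀ i, Loc G A.Q i)
    (a : V → Fin R) (i : V) : Loc G A.Q i :=
  update A sel R ph i (s i) (inbox ph s i) (a i)

theorem hasVote_inbox {s : ∀ i, Loc G A.Q i} {i j : V} {r : ℕ} :
    HasVote (s i) (inbox .p2 s i) j r ↔ (j = i ∨ G.Adj i j) ∧ (s j).g = true ∧ r = (s j).r := by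
  simp only [HasVote, inbox, bcast]
  constructor
  · rintro (⟨rfl, hg, hr⟩ | ⟨h, hm⟩)
    · exact ⟨Or.inl rfl, hg, hr⟩
    · split_ifs at hm with hg
      · simp only [Option.some.injEq, Msg.vote.injEq] at hm
        exact ⟨Or.inr h, hg, hm.symm⟩
  · rintro ⟨rfl | h, hg, hr⟩
    · exact Or.inl ⟨rfl, hg, hr⟩
    · exact Or.inr ⟨h, by simp [hg, hr]⟩

theorem isCandidate_inbox {s : ∀ i, Loc G A.Q i} {i j : V} :
    IsCandidate (s i) (inbox .p2 s i) j ↔ ((j = i ∨ G.Adj i j) ∧ (s j).g = true) ∧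
      ∀ k, (k = i ∨ G.Adj i k) → (s k).g = true → k ≠ j → (s k).r < (s j).r := by
  simp only [IsCandidate, hasVote_inbox]
  constructor
  · rintro ⟨r, ⟨h1, h2, rfl⟩, h⟩
    exact ⟨⟨h1, h2⟩, fun k hk hg hkj => h k _ ⟨hk, hg, rfl⟩ hkj⟩
  · rintro ⟨⟨h1, h2⟩, h⟩
    refine ⟨_, ⟨h1, h2, rfl⟩, ?_⟩
    rintro k r ⟨hk, hg, rfl⟩ hkj
    exact h k hk hg hkj

theorem nextLoc_p2_w {sel : A.Selector} {R : ℕ} {s : ∀ i, Loc G A.Q i} {a : V → Fin R} {i j : V} :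
    (nextLoc sel R .p2 s a i).w = some j ↔ ((j = i ∨ G.Adj i j) ∧ (s j).g = true) ∧
      ∀ k, (k = i ∨ G.Adj i k) → (s k).g = true → k ≠ j → (s k).r < (s j).r := by
  rw [← isCandidate_inbox]
  simp only [nextLoc, update]
  split_ifs with h
  · have hc := h.choose_spec
    rw [Option.some_inj]
    constructor
    · intro he
      exact he ▸ hc
    · intro hj
      -- Two distinct candidates would each have a vote strictly below the other's, so the arbitrary
      -- choice in `update` is forced.
      by_contra hne
      rw [isCandidate_inbox] at hc hj
      have h1 := hc.2 j hj.1.1 hj.1.2 (Ne.symm hne)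
      have h2 := hj.2 _ hc.1.1 hc.1.2 hne
      omega
  · simp only [false_iff]
    exact fun hj => h ⟨j, hj⟩

section Phase1

variable (sel : A.Selector) (R : ℕ) (s : ∀ i, Loc G A.Q i) (a : V → Fin R) (i : V)

/-- Every neighbor broadcasts in Phase 1, so the guards are evaluated on true states, whatever the
old cache contained. -/
theorem nextLoc_p1_g :
    (nextLoc sel R .p1 s a i).g = true ↔ A.Enabled (fun j => (s j).x) i := by
  classical exact decide_eq_true_iff

theorem nextLoc_p1_r (h : A.Enabled (fun j => (s j).x) i) :
    (nextLoc sel R .p1 s a i).r = a i + 1 := if_pos h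

theorem nextLoc_p2_g : (nextLoc sel R .p2 s a i).g = (s i).g := rfl

theorem nextLoc_p3_g : (nextLoc sel R .p3 s a i).g = (s i).g := by
  simp only [nextLoc, update]; split_ifs <;> rfl

theorem nextLoc_p3_w : (nextLoc sel R .p3 s a i).w = (s i).w := by
  simp only [nextLoc, update]; split_ifs <;> rfl

theorem nextLoc_p4_g : (nextLoc sel R .p4 s a i).g = (s i).g := by
  simp only [nextLoc, update]; split_ifs <;> rfl

theorem nextLoc_p4_w : (nextLoc sel R .p4 s a i).w = (s i).w := by
  simp only [nextLoc, update]; split_ifs <;> rfl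

theorem nextLoc_p4_executed : (nextLoc sel R .p4 s a i).executed = (s i).executed := by
  simp only [nextLoc, update]; split_ifs <;> rfl

end Phase1

/-- In Phase 3, process `i` executes a command. -/
def Executes (s : ∀ i, Loc G A.Q i) (i : V) : Prop :=
  ((s i).w ≠ none ∧ ∀ j, G.Adj i j → (s j).w = some i) ∧ A.EnabledAt i (s i).view

theorem inbox_p3 {s : ∀ i, Loc G A.Q i} {i j : V} (h : G.Adj i j) (k : V) :
    inbox .p3 s i j h = some (.winner k) ↔ (s j).w = some k := by
  simp [inbox, bcast]

theorem executes_iff {s : ∀ i, Loc G A.Q i} {i : V} :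
    Executes s i ↔ (((s i).w ≠ none ∧ ∀ j h, inbox .p3 s i j h = some (.winner i)) ∧
      A.EnabledAt i (s i).view) := by
  simp only [Executes, inbox_p3]

/-- The values computed by the command that an enabled process executes. -/
noncomputable def outcome (sel : A.Selector) (i : V) (v : NbhdView G A.Q i)
    (h : A.EnabledAt i v) : NbhdView G A.Q i :=
  A.command i (sel i v h).1 v

theorem nextLoc_p3_of_executes {sel : A.Selector} {R : ℕ} {s : ∀ i, Loc G A.Q i} {a : V → Fin R}
    {i : V} (h : Executes s i) :
    (nextLoc sel R .p3 s a i).view = outcome sel i (s i).view h.2 ∧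
      (nextLoc sel R .p3 s a i).executed = true := by
  have h' := executes_iff.1 h
  simp only [nextLoc, update]
  rw [dif_pos h']
  exact ⟨rfl, rfl⟩

theorem nextLoc_p3_of_not_executes {sel : A.Selector} {R : ℕ} {s : ∀ i, Loc G A.Q i}
    {a : V → Fin R} {i : V} (h : ¬ Executes s i) :
    (nextLoc sel R .p3 s a i).x = (s i).x ∧ (nextLoc sel R .p3 s a i).C = (s i).C ∧
      (nextLoc sel R .p3 s a i).executed = false := by
  rw [executes_iff] at h
  simp only [nextLoc, update]
  rw [dif_neg h]
  exact ⟨rfl, rfl, rfl⟩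

theorem receivesWrite_inbox {s : ∀ i, Loc G A.Q i} {i : V} {y : A.Q i} :
    ReceivesWrite (inbox .p4 s i) y ↔
      ∃ j, ∃ h : G.Adj i j, (s j).executed = true ∧ (s j).C i h.symm = y := by
  simp only [ReceivesWrite, inbox, bcast]
  constructor
  · rintro ⟨j, h, v, hm, hy⟩
    split_ifs at hm with he
    simp only [Option.some.injEq, Msg.values.injEq] at hm
    subst hm
    exact ⟨j, h, he, hy⟩
  · rintro ⟨j, h, he, hy⟩
    exact ⟨j, h, (s j).view, by simp [he], hy⟩

/-- With a single executing neighbor, the arbitrary choice among received values has only one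
possible result. -/
theorem nextLoc_p4_of_receives {sel : A.Selector} {R : ℕ} {s : ∀ i, Loc G A.Q i}
    {a : V → Fin R} {i j : V} (h : G.Adj i j) (he : (s j).executed = true)
    (hu : ∀ k, G.Adj i k → (s k).executed = true → k = j) :
    (nextLoc sel R .p4 s a i).x = (s j).C i h.symm := by
  have hex : ∃ y, ReceivesWrite (inbox .p4 s i) y := ⟨_, receivesWrite_inbox.2 ⟨j, h, he, rfl⟩⟩
  simp only [nextLoc, update]
  rw [dif_pos hex]
  obtain ⟨k, hk, hke, hky⟩ := receivesWrite_inbox.1 hex.choose_spec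
  obtain rfl := hu k hk hke
  exact hky.symm

theorem not_receives_of_not_executed {s : ∀ i, Loc G A.Q i} {i : V}
    (h : ∀ j, G.Adj i j → (s j).executed = false) :
    ¬ ∃ y, ReceivesWrite (inbox .p4 s i) y := by
  rintro ⟨y, hy⟩
  obtain ⟨j, hj, he, -⟩ := receivesWrite_inbox.1 hy
  simp [h j hj] at he

theorem nextLoc_p4_of_not_receives {sel : A.Selector} {R : ℕ} {s : ∀ i, Loc G A.Q i}
    {a : V → Fin R} {i : V} (h : ∀ j, G.Adj i j → (s j).executed = false) :
    (nextLoc sel R .p4 s a i).x = (s i).x ∧ (nextLoc sel R .p4 s a i).C = (s i).C ∧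
      (nextLoc sel R .p4 s a i).updated = false := by
  simp only [nextLoc, update]
  rw [dif_neg (not_receives_of_not_executed h)]
  refine ⟨rfl, ?_, rfl⟩
  funext j hj
  simp [refresh, inbox, bcast, h j hj]

/-! ### A cycle as a sequence of moves -/

/-- The local variables after the first two phases of a cycle. -/
noncomputable def voted (sel : A.Selector) (R : ℕ) (s : ∀ i, Loc G A.Q i) (a : ℕ → V → Fin R) :
    ∀ i, Loc G A.Q i :=
  nextLoc sel R .p2 (nextLoc sel R .p1 s (a 0)) (a 1)

/-- The local variables after the first four phases of a cycle. -/
noncomputable def propagated (sel : A.Selector) (R : ℕ) (s : ∀ i, Loc G A.Q i)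
    (a : ℕ → V → Fin R) : ∀ i, Loc G A.Q i :=
  nextLoc sel R .p4 (nextLoc sel R .p3 (voted sel R s a) (a 2)) (a 3)

variable {sel : A.Selector} {R : ℕ} {s : ∀ i, Loc G A.Q i} {a : ℕ → V → Fin R}

/-- Only enabled processes vote, and they have just redrawn `r`, so stale votes play no role and the
coins `a 0` of Phase 1 decide. -/
theorem voted_w {i j : V} :
    (voted sel R s a i).w = some j ↔
      ((j = i ∨ G.Adj i j) ∧ A.Enabled (fun k => (s k).x) j) ∧
        ∀ k, (k = i ∨ G.Adj i k) → A.Enabled (fun k => (s k).x) k → k ≠ j → a 0 k < a 0 j := by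
  rw [voted, nextLoc_p2_w]
  simp only [nextLoc_p1_g]
  refine and_congr_right fun h => forall₄_congr fun k _ hk _ => ?_
  rw [nextLoc_p1_r _ _ _ _ _ hk, nextLoc_p1_r _ _ _ _ _ h.2, Fin.lt_def]
  omega

/-- The guard in Phase 3 is tested on the cache refreshed in Phase 1, with `x` unchanged since, so
this is the true view by unfolding. -/
theorem enabled_of_executes {i : V} (h : Executes (voted sel R s a) i) :
    A.Enabled (fun k => (s k).x) i := h.2

/-- Adjacent winners would have to name each other, making each vote strictly larger than the other.
-/
theorem not_adj_of_executes {i j : V} (hi : Executes (voted sel R s a) i)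
    (hj : Executes (voted sel R s a) j) : ¬ G.Adj i j := by
  intro h
  have h1 := voted_w.1 (hi.1.2 j h)
  have h2 := voted_w.1 (hj.1.2 i h.symm)
  have h3 := h1.2 j (Or.inl rfl) hj.2 h.ne'
  have h4 := h2.2 i (Or.inl rfl) hi.2 h.ne
  exact lt_asymm h3 h4

/-- A common neighbor names only one winner. -/
theorem eq_of_executes_of_adj {i j k : V} (hi : Executes (voted sel R s a) i)
    (hj : Executes (voted sel R s a) j) (hik : G.Adj i k) (hjk : G.Adj j k) : i = j :=
  Option.some_inj.1 ((hi.1.2 k hik).symm.trans (hj.1.2 k hjk))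

/-- A unique maximum vote among all enabled processes lets its process execute a command. -/
theorem executes_of_forall_lt {i : V} (hi : A.Enabled (fun k => (s k).x) i)
    (hmax : ∀ k, A.Enabled (fun k => (s k).x) k → k ≠ i → a 0 k < a 0 i) :
    Executes (voted sel R s a) i := by
  refine ⟨⟨?_, fun j hj => ?_⟩, hi⟩
  · have : (voted sel R s a i).w = some i :=
      voted_w.2 ⟨⟨Or.inl rfl, hi⟩, fun k _ => hmax k⟩
    simp [this]
  · exact voted_w.2 ⟨⟨Or.inr hj.symm, hi⟩, fun k _ => hmax k⟩

theorem executed_p3 {b : V → Fin R} {i : V} :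
    (nextLoc sel R .p3 s b i).executed = true ↔ Executes s i := by
  constructor
  · intro h
    by_contra hn
    simp [(nextLoc_p3_of_not_executes (sel := sel) (a := b) hn).2.2] at h
  · exact fun h => (nextLoc_p3_of_executes h).2

/-- One cycle simulates one move of each process that executes a command in Phase 3. -/
theorem steps_propagated [Fintype V] [DecidableEq V] [DecidablePred (Executes (voted sel R s a))] :
    A.Steps (Finset.univ.filter (Executes (voted sel R s a))).card (fun i => (s i).x)
      (fun i => (propagated sel R s a i).x) := by
  classical
  refine R1W1Alg.steps_of_disjoint_moves
    (fun i => (nextLoc sel R .p3 (voted sel R s a) (a 2) i).view) _ _ ?_ ?_ ?_ ?_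
  · intro i hi
    have hi' := (Finset.mem_filter.1 hi).2
    exact ⟨_, (sel i _ hi'.2).2, (nextLoc_p3_of_executes hi').1⟩
  · intro i hi j hj hij
    have hi' := (Finset.mem_filter.1 hi).2
    have hj' := (Finset.mem_filter.1 hj).2
    exact ⟨not_adj_of_executes hi' hj', fun k hik hjk => hij (eq_of_executes_of_adj hi' hj' hik hjk)⟩
  · intro i hi
    have hi' := (Finset.mem_filter.1 hi).2
    refine ⟨?_, fun j hj => ?_⟩
    · refine (nextLoc_p4_of_not_receives fun j hj => ?_).1
      by_contra he
      rw [Bool.not_eq_false, executed_p3] at he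
      exact not_adj_of_executes hi' he hj
    · refine nextLoc_p4_of_receives hj.symm (executed_p3.2 hi') fun k hk hke => ?_
      exact eq_of_executes_of_adj (executed_p3.1 hke) hi' hk.symm hj
  · intro j hj hadj
    have hj' : ¬ Executes (voted sel R s a) j := fun h => hj (by simp [h])
    refine (nextLoc_p4_of_not_receives fun i hi => ?_).1.trans
      (nextLoc_p3_of_not_executes hj').1
    by_contra he
    rw [Bool.not_eq_false, executed_p3] at he
    exact hadj i (by simp [he]) hi.symm

/-- If no process is enabled in the simulated configuration, then after four phases nothing is
pending and the cache is coherent. -/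
theorem propagated_of_not_enabled (h : ∀ i, ¬ A.Enabled (fun k => (s k).x) i) :
    (∀ i, (propagated sel R s a i).x = (s i).x) ∧
    (∀ i j (hij : G.Adj i j), (propagated sel R s a i).C j hij = (propagated sel R s a j).x) ∧
    ∀ i, (propagated sel R s a i).g = false ∧ (propagated sel R s a i).w = none ∧
      (propagated sel R s a i).executed = false ∧ (propagated sel R s a i).updated = false := by
  have hne : ∀ i, ¬ Executes (voted sel R s a) i := fun i hi => h i (enabled_of_executes hi)
  have h3 := fun i => nextLoc_p3_of_not_executes (sel := sel) (a := a 2) (hne i)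
  have h4 := fun i => nextLoc_p4_of_not_receives (sel := sel) (a := a 3) (i := i)
    (fun j _ => (h3 j).2.2)
  have hx : ∀ i, (propagated sel R s a i).x = (s i).x := fun i => (h4 i).1.trans (h3 i).1
  refine ⟨hx, fun i j hij => ?_, fun i => ⟨?_, ?_, ?_, (h4 i).2.2⟩⟩
  · have hC : (propagated sel R s a i).C = fun k _ => (s k).x :=
      (h4 i).2.1.trans (h3 i).2.1
    rw [hx, hC]
  · rw [propagated, nextLoc_p4_g, nextLoc_p3_g, voted, nextLoc_p2_g, ← Bool.not_eq_true,
      nextLoc_p1_g]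
    exact h i
  · rw [propagated, nextLoc_p4_w, nextLoc_p3_w, Option.eq_none_iff_forall_ne_some]
    exact fun j hj => h j (voted_w.1 hj).1.2
  · rw [propagated, nextLoc_p4_executed]
    exact (h3 i).2.2

end TrR1W1

open MeasureTheory

/-! ### Independent uniform numbers: rotating one coordinate -/

section Resampling

variable {ι : Type*} {N : ℕ}

/-- The law of independent random numbers, each uniform on `Fin N`. -/
noncomputable def uniformProduct (ι : Type*) (N : ℕ) [NeZero N] : Measure (ι → Fin N) :=
  Measure.infinitePi fun _ => (PMF.uniformOfFintype (Fin N)).toMeasure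

instance [NeZero N] : IsProbabilityMeasure (uniformProduct ι N) := by
  unfold uniformProduct; infer_instance

theorem map_add_right_uniform [NeZero N] (k : Fin N) :
    (PMF.uniformOfFintype (Fin N)).toMeasure.map (· + k) =
      (PMF.uniformOfFintype (Fin N)).toMeasure := by
  refine Measure.ext_of_singleton fun a => ?_
  rw [Measure.map_apply (by fun_prop) (measurableSet_singleton a)]
  have : (fun x : Fin N => x + k) ⁻¹' {a} = {a - k} := by
    ext x; exact eq_sub_iff_add_eq.symm
  rw [this, PMF.toMeasure_apply_singleton _ _ (measurableSet_singleton _),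
    PMF.toMeasure_apply_singleton _ _ (measurableSet_singleton _)]
  simp

/-- Rotation of a single random number preserves the law. -/
theorem measurePreserving_rotate [DecidableEq ι] [NeZero N] (p : ι) (k : Fin N) :
    MeasurePreserving (fun ω : ι → Fin N => Function.update ω p (ω p + k))
      (uniformProduct ι N) (uniformProduct ι N) := by
  have hfun : (fun ω : ι → Fin N => Function.update ω p (ω p + k)) =
      fun ω q => (if q = p then (· + k) else id : Fin N → Fin N) (ω q) := by
    funext ω q
    by_cases h : q = p
    · subst h; simp
    · simp [h]
  have hmeas : ∀ q, Measurable (if q = p then (· + k) else id : Fin N → Fin N) :=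
    fun q => measurable_of_finite _
  rw [hfun]
  refine ⟨measurable_pi_lambda _ fun q => (hmeas q).comp (measurable_pi_apply q), ?_⟩
  unfold uniformProduct
  rw [Measure.infinitePi_map_pi _ hmeas]
  congr 1
  funext q
  by_cases h : q = p
  · simp only [h, if_true]
    exact map_add_right_uniform k
  · simp only [h, if_false]
    exact Measure.map_id

/-- An event that, given all other random numbers, prescribes the value of the random number with
index `p` has at most `1 / N` of the probability of any larger event that does not depend on that
random number. -/
theorem card_mul_measure_le [DecidableEq ι] [NeZero N] (p : ι) {B S : Set (ι → Fin N)}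
    (hB : MeasurableSet B) (hBS : B ⊆ S)
    (hS : ∀ ω u, Function.update ω p u ∈ S → ω ∈ S)
    (huniq : ∀ ω u v, Function.update ω p u ∈ B → Function.update ω p v ∈ B → u = v) :
    N * uniformProduct ι N B ≤ uniformProduct ι N S := by
  -- The `N` rotations of coordinate `p`, modulo `N`, pull `B` back to pairwise disjoint sets of
  -- equal measure, all contained in `S`.
  let rot (k : Fin N) (ω : ι → Fin N) : ι → Fin N := Function.update ω p (ω p + k)
  have hdisj : Pairwise (Function.onFun Disjoint fun k => rot k ⁻¹' B) := by
    intro k l hkl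
    refine Set.disjoint_left.2 fun ω hk hl => hkl ?_
    exact add_left_cancel (huniq ω _ _ hk hl)
  calc N * uniformProduct ι N B = ∑ k : Fin N, uniformProduct ι N (rot k ⁻¹' B) := by
        simp [fun k => (measurePreserving_rotate p k).measure_preimage hB.nullMeasurableSet, rot]
    _ = uniformProduct ι N (⋃ k, rot k ⁻¹' B) := by
        rw [measure_iUnion hdisj fun k => (measurePreserving_rotate p k).measurable hB, tsum_fintype]
    _ ≤ uniformProduct ι N S :=
        measure_mono (Set.iUnion_subset fun k ω hω => hS ω _ (hBS hω))

/-- An event determined by finitely many random numbers is measurable. -/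
theorem measurableSet_of_finite_dependence (I : Finset ι) {B : Set (ι → Fin N)}
    (hB : ∀ ω ω' : ι → Fin N, (∀ q ∈ I, ω q = ω' q) → ω ∈ B → ω' ∈ B) : MeasurableSet B := by
  -- `B` is a cylinder over a subset of the finite type `I → Fin N`.
  have : B = I.restrict ⁻¹' (I.restrict '' B) := by
    refine (Set.subset_preimage_image _ _).antisymm ?_
    rintro ω ⟨ω', hω', h⟩
    exact hB ω' ω (fun q hq => congrFun h ⟨q, hq⟩) hω'
  rw [this]
  exact (Set.toFinite _).measurableSet.preimage (Finset.measurable_restrict I)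

end Resampling

namespace SyncMPAlg

variable {V : Type} {G : SimpleGraph V} (B : SyncMPAlg G)

/-- The configuration after `t` rounds depends only on the random numbers of these rounds. -/
theorem run_congr (c : B.Config) {ω ω' : B.Coins} {t : ℕ}
    (h : ∀ q : ℕ × V, q.1 < t → ω q = ω' q) : B.run c ω t = B.run c ω' t := by
  induction t with
  | zero => rfl
  | succ t ih =>
    simp only [run]
    rw [ih fun q hq => h q (by omega), funext fun i => h (t, i) (Nat.lt_succ_self t)]

theorem stabilizationTime_le {L : Set B.Config} {c : B.Config} {ω : B.Coins} {t : ℕ}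
    (h : B.run c ω t ∈ L) : B.stabilizationTime L c ω ≤ t :=
  iInf₂_le t h

theorem exists_mem_of_stabilizationTime_ne_top {L : Set B.Config} {c : B.Config} {ω : B.Coins}
    (h : B.stabilizationTime L c ω ≠ ⊤) : ∃ t, B.run c ω t ∈ L := by
  by_contra! hne
  exact h (by simp [stabilizationTime, hne])

end SyncMPAlg

namespace TrR1W1

open SyncMPAlg

/-! ### Closure of the legitimate configurations -/

section Closure

variable {V : Type} {G : SimpleGraph V} {A : R1W1Alg G} {L : Set A.Config}

theorem round_mem_legitimate (hs : A.Silent L) (sel : A.Selector) (R : ℕ) [NeZero R]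
    {c : (transform A sel R).Config} (hc : c ∈ legitimate A L sel R)
    (a : V → Fin R) :
    (transform A sel R).round c a ∈ legitimate A L sel R := by
  obtain ⟨ph, s⟩ := c
  obtain ⟨hL, hC, hp⟩ := hc
  change ∀ i, Loc G A.Q i at s
  change (fun i => (s i).x) ∈ L at hL
  change ∀ i j (h : G.Adj i j), (s i).C j h = (s j).x at hC
  change ∀ i, (s i).g = false ∧ (s i).w = none ∧ (s i).executed = false ∧ (s i).updated = false
    at hp
  -- Legitimacy does not mention `r`, so it suffices that every phase fixes all other variables: by
  -- silence and coherence, messages only repeat cached values and no guard is true.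
  suffices h : ∀ i, nextLoc sel R ph s a i = { s i with r := (nextLoc sel R ph s a i).r } by
    have h' : ∀ i, ((transform A sel R).round ⟨ph, s⟩ a).loc i =
      { s i with r := (nextLoc sel R ph s a i).r } := h
    refine ⟨?_, fun i j hij => ?_, fun i => ?_⟩
    · change (fun i => Loc.x (((transform A sel R).round ⟨ph, s⟩ a).loc i)) ∈ L
      simpa only [h'] using hL
    · rw [h', h']
      exact hC i j hij
    · rw [h']
      exact hp i
  intro i
  have hCi : (fun (j : V) (_ : G.Adj i j) => (s j).x) = (s i).C :=
    funext fun j => funext fun h => (hC i j h).symm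
  obtain ⟨hg, hw, he, hu⟩ := hp i
  cases ph with
  | p1 =>
    have hg' : (nextLoc sel R .p1 s a i).g = (s i).g := by
      rw [hg, ← Bool.not_eq_true, nextLoc_p1_g]
      exact hs _ hL i
    change (⟨(s i).x, fun j _ => (s j).x, (nextLoc sel R .p1 s a i).r,
      (nextLoc sel R .p1 s a i).g, _, _, _⟩ : Loc G A.Q i) = _
    rw [hg', hCi]
  | p2 =>
    have hw' : (nextLoc sel R .p2 s a i).w = (s i).w := by
      rw [hw, Option.eq_none_iff_forall_ne_some]
      intro j hj
      have := (nextLoc_p2_w.1 hj).1.2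
      simp [(hp j).1] at this
    change (⟨_, _, _, _, (nextLoc sel R .p2 s a i).w, _, _⟩ : Loc G A.Q i) = _
    rw [hw']
    rfl
  | p3 =>
    have hne : ¬ Executes s i := fun h => h.1.1 hw
    rw [executes_iff] at hne
    simp only [nextLoc, update]
    rw [dif_neg hne]
    simp [← he]
  | p4 =>
    have h := nextLoc_p4_of_not_receives (sel := sel) (a := a) (i := i) fun j _ => (hp j).2.2.1
    have h1 := not_receives_of_not_executed (s := s) (i := i) fun j _ => (hp j).2.2.1
    have h2 : refresh (s i).C (inbox .p4 s i) = (s i).C := by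
      funext j hj
      simp [refresh, inbox, bcast, (hp j).2.2.1]
    simp only [nextLoc, update]
    rw [dif_neg h1, h2, ← hu]
  | p5 =>
    have h2 : refresh (s i).C (inbox .p5 s i) = (s i).C := by
      funext j hj
      simp [refresh, inbox, bcast, (hp j).2.2.2]
    simp only [nextLoc, update]
    rw [h2]

end Closure

/-! ### Cycles within a run -/

section Cycle

variable {V : Type} {G : SimpleGraph V} {A : R1W1Alg G} {L : Set A.Config} {sel : A.Selector}
  {R : ℕ} [NeZero R] {c : (transform A sel R).Config} {ω : (transform A sel R).Coins} {t : ℕ}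

/-- The phase shown by the clock. -/
def phase (c : (transform A sel R).Config) : Phase := c.clock

/-- The number of rounds until the next cycle starts. -/
def Phase.remaining : Phase → ℕ
  | p1 => 0
  | p2 => 4
  | p3 => 3
  | p4 => 2
  | p5 => 1

theorem Phase.remaining_le (ph : Phase) : ph.remaining ≤ 4 := by
  cases ph <;> decide

theorem phase_run (t : ℕ) :
    phase ((transform A sel R).run c ω t) = Phase.next^[t] (phase c) := by
  induction t with
  | zero => rfl
  | succ t ih =>
    rw [Function.iterate_succ_apply', ← ih]
    rfl

theorem phase_run_cycle (m : ℕ) :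
    phase ((transform A sel R).run c ω ((phase c).remaining + 5 * m)) = Phase.p1 := by
  have h5 : Phase.next^[5] = id := by funext ph; cases ph <;> rfl
  rw [phase_run, Function.iterate_add_apply, Function.iterate_mul, h5, Function.iterate_id, id]
  cases phase c <;> rfl

theorem run_add_four (h : phase ((transform A sel R).run c ω t) = Phase.p1) :
    (transform A sel R).run c ω (t + 4) =
      ⟨Phase.p5, propagated sel R ((transform A sel R).run c ω t).loc fun k i => ω (t + k, i)⟩ := by
  change (transform A sel R).round ((transform A sel R).round ((transform A sel R).round
    ((transform A sel R).round ((transform A sel R).run c ω t) _) _) _) _ = _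
  rcases hc : (transform A sel R).run c ω t with ⟨ph, s⟩
  rw [hc] at h
  obtain rfl : ph = Phase.p1 := h
  rfl

/-- Phase 5 changes only caches, so the simulated configuration is final after four rounds. -/
theorem simulated_run_add_five (h : phase ((transform A sel R).run c ω t) = Phase.p1) :
    simulated A sel R ((transform A sel R).run c ω (t + 5)) = fun i =>
      (propagated sel R ((transform A sel R).run c ω t).loc (fun k i => ω (t + k, i)) i).x := by
  rw [show t + 5 = t + 4 + 1 from rfl, run, run_add_four h]
  rfl

/-- By silence nobody is enabled, so the first four phases reset all inherited flags and candidates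
and rebuild the caches without changing `x`. -/
theorem run_add_four_mem_legitimate (hs : A.Silent L)
    (h : phase ((transform A sel R).run c ω t) = Phase.p1)
    (hL : simulated A sel R ((transform A sel R).run c ω t) ∈ L) :
    (transform A sel R).run c ω (t + 4) ∈ legitimate A L sel R := by
  obtain ⟨hx, hC, hp⟩ := propagated_of_not_enabled (sel := sel) (R := R)
    (a := fun k i => ω (t + k, i)) (hs _ hL)
  rw [run_add_four h]
  refine ⟨?_, hC, hp⟩
  change (fun i => (propagated sel R _ _ i).x) ∈ L
  rw [funext hx]
  exact hL

/-- The vote drawn by `i` in round `t` is tied for the maximum among the enabled processes. -/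
def TiedMaximum (sel : A.Selector) (R : ℕ) [NeZero R] (c : (transform A sel R).Config) (t : ℕ)
    (i : V) (ω : (transform A sel R).Coins) : Prop :=
  (∃ j, j ≠ i ∧ A.Enabled (simulated A sel R ((transform A sel R).run c ω t)) j ∧
    ω (t, j) = ω (t, i)) ∧
  ∀ k, A.Enabled (simulated A sel R ((transform A sel R).run c ω t)) k → ω (t, k) ≤ ω (t, i)

/-- Here `k` counts the executing processes. An enabled process with the maximum vote, if not tied,
beats all enabled processes and hence executes. -/
theorem steps_cycle [Finite V] (h : phase ((transform A sel R).run c ω t) = Phase.p1) :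
    ∃ k, A.Steps k (simulated A sel R ((transform A sel R).run c ω t))
      (simulated A sel R ((transform A sel R).run c ω (t + 5))) ∧
      ((∃ i, A.Enabled (simulated A sel R ((transform A sel R).run c ω t)) i) →
        (∀ i, ¬ TiedMaximum sel R c t i ω) → 1 ≤ k) := by
  classical
  have := Fintype.ofFinite V
  rw [simulated_run_add_five h]
  refine ⟨_, steps_propagated, fun hen htie => ?_⟩
  obtain ⟨i, hi, hmax⟩ := (Set.toFinite
    {i | A.Enabled (simulated A sel R ((transform A sel R).run c ω t)) i}).exists_maximalFor
      (fun i => ω (t, i)) _ hen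
  have hle : ∀ k, A.Enabled (simulated A sel R ((transform A sel R).run c ω t)) k →
      ω (t, k) ≤ ω (t, i) := fun k hk => (le_total _ _).elim id (hmax hk)
  refine Finset.card_pos.2 ⟨i, Finset.mem_filter.2 ⟨Finset.mem_univ i,
    executes_of_forall_lt hi fun k hk hki => ?_⟩⟩
  refine lt_of_le_of_ne (hle k hk) fun he => htie i ⟨⟨k, hki, hk, he⟩, hle⟩

end Cycle

/-! ### Expected number of illegitimate cycles -/

section Expectation

variable {V : Type} {G : SimpleGraph V} {A : R1W1Alg G} {L : Set A.Config}
  {sel : A.Selector} {R : ℕ} [NeZero R] {c : (transform A sel R).Config} {T : ℕ}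

/-- The start of the cycle with number `m`. -/
def cycleStart (c : (transform A sel R).Config) (m : ℕ) : ℕ := (phase c).remaining + 5 * m

/-- The simulated configuration at the start of the cycle with number `m` is not legitimate. -/
def illegitimateCycle (L : Set A.Config) (c : (transform A sel R).Config) (m : ℕ) :
    Set (ℕ × V → Fin R) :=
  {ω | simulated A sel R ((transform A sel R).run c ω (cycleStart c m)) ∉ L}

/-- In the cycle with number `m`, the maximum vote is attained by several processes, and `i` is
one of them. -/
def tiedCycle (L : Set A.Config) (c : (transform A sel R).Config) (m : ℕ) (i : V) :
    Set (ℕ × V → Fin R) :=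
  illegitimateCycle L c m ∩ {ω | TiedMaximum sel R c (cycleStart c m) i ω}

/-- The cycle with number `m` starts in an illegitimate configuration, and the maximum vote is
attained by a single process. -/
def productiveCycle (L : Set A.Config) (c : (transform A sel R).Config) (m : ℕ) :
    Set (ℕ × V → Fin R) :=
  illegitimateCycle L c m \ ⋃ i, tiedCycle L c m i

/-- The strict inequality matters: the votes of cycle `m` are drawn in round `cycleStart c m` and so
do not affect its starting configuration. -/
theorem illegitimateCycle_congr {m : ℕ} {ω ω' : ℕ × V → Fin R}
    (h : ∀ q : ℕ × V, q.1 < cycleStart c m → ω q = ω' q) :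
    ω ∈ illegitimateCycle L c m ↔ ω' ∈ illegitimateCycle L c m := by
  simp only [illegitimateCycle, Set.mem_ofPred_eq]
  rw [run_congr (transform A sel R) c (ω := ω) (ω' := ω') h]

/-- At most 4 rounds pass before the first cycle, 5 in each cycle before the first legitimate start,
and 4 more to clear pending data. If no start is legitimate, the right side is infinite. -/
theorem stabilizationTime_le_tsum (hs : A.Silent L) (ω : ℕ × V → Fin R) :
    (transform A sel R).stabilizationTime (legitimate A L sel R) c ω ≤
      8 + 5 * ∑' m, (illegitimateCycle L c m).indicator (1 : (ℕ × V → Fin R) → ENNReal) ω := by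
  classical
  by_cases h : ∃ N, ω ∉ illegitimateCycle L c N
  · obtain ⟨N, hN, hlt⟩ : ∃ N, ω ∉ illegitimateCycle L c N ∧
        ∀ m < N, ω ∈ illegitimateCycle L c m :=
      ⟨Nat.find h, Nat.find_spec h, fun m hm => not_not.1 (Nat.find_min h hm)⟩
    have hsum : (N : ENNReal) ≤ ∑' m, (illegitimateCycle L c m).indicator (1 : (ℕ × V → Fin R) → ENNReal) ω := by
      calc (N : ENNReal)
          = ∑ m ∈ Finset.range N, (illegitimateCycle L c m).indicator (1 : (ℕ × V → Fin R) → ENNReal) ω := by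
            rw [Finset.sum_congr rfl fun m hm => Set.indicator_of_mem
              (hlt m (Finset.mem_range.1 hm)) _]
            simp
        _ ≤ _ := ENNReal.sum_le_tsum _
    have hmem := run_add_four_mem_legitimate hs (phase_run_cycle (c := c) (ω := ω) N) (not_not.1 hN)
    refine (stabilizationTime_le _ hmem).trans ?_
    calc (((phase c).remaining + 5 * N + 4 : ℕ) : ENNReal) ≤ ((8 + 5 * N : ℕ) : ENNReal) := by
          have := (phase c).remaining_le
          exact Nat.cast_le.2 (by omega)
      _ = 8 + 5 * (N : ENNReal) := by push_cast; rfl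
      _ ≤ _ := by gcongr
  · push Not at h
    have : ∑' m, (illegitimateCycle L c m).indicator (1 : (ℕ × V → Fin R) → ENNReal) ω = ⊤ := by
      rw [tsum_congr fun m => Set.indicator_of_mem (h m) _]
      simp
    simp [this]

variable [Fintype V]

theorem measurableSet_illegitimateCycle (m : ℕ) :
    MeasurableSet (illegitimateCycle L c m) := by
  refine measurableSet_of_finite_dependence (Finset.range (cycleStart c m) ×ˢ Finset.univ)
    fun ω ω' h => (illegitimateCycle_congr fun q hq => h q (by simp [hq])).1

theorem measurableSet_tiedCycle (m : ℕ) (i : V) : MeasurableSet (tiedCycle L c m i) := by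
  refine measurableSet_of_finite_dependence (Finset.range (cycleStart c m + 1) ×ˢ Finset.univ)
    fun ω ω' h => ?_
  have h1 : ∀ q : ℕ × V, q.1 < cycleStart c m → ω q = ω' q :=
    fun q hq => h q (by simp; omega)
  have h2 : ∀ j, ω (cycleStart c m, j) = ω' (cycleStart c m, j) := fun j => h _ (by simp)
  rintro ⟨hi, ht⟩
  refine ⟨(illegitimateCycle_congr h1).1 hi, ?_⟩
  simp only [Set.mem_ofPred_eq, TiedMaximum] at ht ⊢
  rw [run_congr (transform A sel R) c (ω := ω) (ω' := ω') h1] at ht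
  simpa only [h2] using ht

theorem measurableSet_productiveCycle (m : ℕ) : MeasurableSet (productiveCycle L c m) :=
  (measurableSet_illegitimateCycle m).diff (.iUnion fun i => measurableSet_tiedCycle m i)

/-- Given all other coins, a tie forces the vote of `i` to equal the maximum vote of the other
enabled processes, so at most one of its `R` values is possible. -/
theorem measure_tiedCycle_le (m : ℕ) (i : V) :
    R * uniformProduct (ℕ × V) R (tiedCycle L c m i) ≤
      uniformProduct (ℕ × V) R (illegitimateCycle L c m) := by
  classical
  have hpast : ∀ (ω : ℕ × V → Fin R) u (q : ℕ × V), q.1 < cycleStart c m →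
      Function.update ω (cycleStart c m, i) u q = ω q := by
    intro ω u q hq
    refine Function.update_of_ne ?_ _ _
    rintro rfl
    exact lt_irrefl _ hq
  refine card_mul_measure_le (cycleStart c m, i) (measurableSet_tiedCycle m i)
    Set.inter_subset_left (fun ω u => (illegitimateCycle_congr (hpast ω u)).1) ?_
  have key : ∀ (ω : ℕ × V → Fin R) u v,
      Function.update ω (cycleStart c m, i) u ∈ tiedCycle L c m i →
      Function.update ω (cycleStart c m, i) v ∈ tiedCycle L c m i → u ≤ v := by
    rintro ω u v ⟨-, ⟨j, hji, hj, he⟩, -⟩ ⟨-, -, hle⟩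
    rw [run_congr (transform A sel R) c (hpast ω u)] at hj
    have h := hle j (by rwa [run_congr (transform A sel R) c (hpast ω v)])
    have hne : (cycleStart c m, j) ≠ (cycleStart c m, i) := by simpa using hji
    rw [Function.update_of_ne hne, Function.update_self] at he h
    exact he ▸ h
  exact fun ω u v hu hv => le_antisymm (key ω u v hu hv) (key ω v u hv hu)

theorem measure_illegitimateCycle_le (hR : 2 * Fintype.card V ≤ R) (m : ℕ) :
    uniformProduct (ℕ × V) R (illegitimateCycle L c m) ≤
      2 * uniformProduct (ℕ × V) R (productiveCycle L c m) := by
  set μ := uniformProduct (ℕ × V) R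
  set S := illegitimateCycle L c m
  have h1 : R * μ (⋃ i, tiedCycle L c m i) ≤ Fintype.card V * μ S := by
    calc R * μ (⋃ i, tiedCycle L c m i) ≤ R * ∑ i, μ (tiedCycle L c m i) := by
          gcongr
          exact measure_iUnion_fintype_le _ _
      _ = ∑ i, R * μ (tiedCycle L c m i) := Finset.mul_sum _ _ _
      _ ≤ ∑ _i : V, μ S := Finset.sum_le_sum fun i _ => measure_tiedCycle_le m i
      _ = Fintype.card V * μ S := by simp
  have h2 : 2 * μ (⋃ i, tiedCycle L c m i) ≤ μ S := by
    have hR0 : (R : ENNReal) ≠ 0 := by exact_mod_cast NeZero.ne R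
    refine (ENNReal.mul_le_mul_iff_right hR0 (ENNReal.natCast_ne_top R)).1 ?_
    calc R * (2 * μ (⋃ i, tiedCycle L c m i)) = 2 * (R * μ (⋃ i, tiedCycle L c m i)) := by ring
      _ ≤ 2 * (Fintype.card V * μ S) := by gcongr
      _ = ((2 * Fintype.card V : ℕ) : ENNReal) * μ S := by push_cast; ring
      _ ≤ R * μ S := by gcongr
  have h3 : μ S ≤ μ (⋃ i, tiedCycle L c m i) + μ (productiveCycle L c m) :=
    (measure_mono (by rw [productiveCycle, Set.union_sdiff_self]; exact Set.subset_union_right)).trans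
      (measure_union_le _ _)
  -- In `ENNReal` the term `μ S` is cancelled rather than subtracted, which needs its finiteness.
  have h4 : μ S + μ S ≤ μ S + 2 * μ (productiveCycle L c m) := by
    calc μ S + μ S = 2 * μ S := (two_mul _).symm
      _ ≤ 2 * (μ (⋃ i, tiedCycle L c m i) + μ (productiveCycle L c m)) := by gcongr
      _ = 2 * μ (⋃ i, tiedCycle L c m i) + 2 * μ (productiveCycle L c m) := mul_add _ _ _
      _ ≤ μ S + 2 * μ (productiveCycle L c m) := by gcongr
  exact (ENNReal.add_le_add_iff_left (measure_ne_top μ S)).1 h4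

/-- At most `T` cycles are productive. -/
theorem tsum_productiveCycle_le (hA : A.SelfStabilizing L) (hs : A.Silent L)
    (hT : A.StabilizesInMoves L T) (ω : ℕ × V → Fin R) :
    ∑' m, (productiveCycle L c m).indicator (1 : (ℕ × V → Fin R) → ENNReal) ω ≤ T := by
  -- The moves of successive cycles concatenate to one sequence, with at least one move per
  -- productive cycle.
  have key : ∀ N : ℕ, ∃ k : ℕ,
      A.Steps k (simulated A sel R ((transform A sel R).run c ω (cycleStart c 0)))
        (simulated A sel R ((transform A sel R).run c ω (cycleStart c N))) ∧
      ∑ m ∈ Finset.range N, (productiveCycle L c m).indicator (1 : (ℕ × V → Fin R) → ENNReal) ω ≤ k := by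
    intro N
    induction N with
    | zero => exact ⟨0, .refl _, by simp⟩
    | succ N ih =>
      obtain ⟨k, hk, hle⟩ := ih
      obtain ⟨l, hl, hl1⟩ := steps_cycle (c := c) (ω := ω) (phase_run_cycle N)
      refine ⟨k + l, hk.trans hl, ?_⟩
      rw [Finset.sum_range_succ, Nat.cast_add]
      refine add_le_add hle ?_
      by_cases h : ω ∈ productiveCycle L c N
      · rw [Set.indicator_of_mem h, Pi.one_apply]
        refine Nat.one_le_cast.2 (hl1 (R1W1Alg.exists_enabled_of_notMem hA h.1) fun i hi => ?_)
        exact h.2 (Set.mem_iUnion.2 ⟨i, h.1, hi⟩)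
      · rw [Set.indicator_of_notMem h]
        exact zero_le
  refine ENNReal.tsum_le_of_sum_range_le fun N => ?_
  obtain ⟨k, hk, hle⟩ := key N
  exact hle.trans (Nat.cast_le.2 (hk.le_of_stabilizesInMoves hs hT))

theorem measurable_illegitimate_tsum :
    Measurable fun ω => 8 + 5 * ∑' m, (illegitimateCycle L c m).indicator (1 : (ℕ × V → Fin R) → ENNReal) ω :=
  (Measurable.const_mul (Measurable.tsum fun m =>
    measurable_one.indicator (measurableSet_illegitimateCycle m)) 5).const_add 8

theorem lintegral_illegitimate_tsum_le (hR : 2 * Fintype.card V ≤ R) (hA : A.SelfStabilizing L)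
    (hs : A.Silent L) (hT : A.StabilizesInMoves L T) :
    ∫⁻ ω, 8 + 5 * ∑' m, (illegitimateCycle L c m).indicator (1 : (ℕ × V → Fin R) → ENNReal) ω
      ∂uniformProduct (ℕ × V) R ≤ 8 + 10 * T := by
  have hm : ∀ m, Measurable
      ((illegitimateCycle L c m).indicator (1 : (ℕ × V → Fin R) → ENNReal)) :=
    fun m => measurable_one.indicator (measurableSet_illegitimateCycle m)
  have hm' : ∀ m, Measurable
      ((productiveCycle L c m).indicator (1 : (ℕ × V → Fin R) → ENNReal)) :=
    fun m => measurable_one.indicator (measurableSet_productiveCycle m)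
  rw [lintegral_add_left measurable_const, lintegral_const, measure_univ, mul_one,
    lintegral_const_mul _ (Measurable.tsum hm), lintegral_tsum fun m => (hm m).aemeasurable]
  simp only [lintegral_indicator_one (measurableSet_illegitimateCycle _)]
  have h : ∑' m, uniformProduct (ℕ × V) R (productiveCycle L c m) ≤ T := by
    calc ∑' m, uniformProduct (ℕ × V) R (productiveCycle L c m)
        = ∫⁻ ω, ∑' m, (productiveCycle L c m).indicator (1 : (ℕ × V → Fin R) → ENNReal) ω
            ∂uniformProduct (ℕ × V) R := by
          rw [lintegral_tsum fun m => (hm' m).aemeasurable]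
          simp only [lintegral_indicator_one (measurableSet_productiveCycle _)]
      _ ≤ ∫⁻ _, T ∂uniformProduct (ℕ × V) R :=
          lintegral_mono fun ω => tsum_productiveCycle_le hA hs hT ω
      _ = T := by simp
  calc 8 + 5 * ∑' m, uniformProduct (ℕ × V) R (illegitimateCycle L c m)
      ≤ 8 + 5 * ∑' m, 2 * uniformProduct (ℕ × V) R (productiveCycle L c m) := by
        gcongr with m
        exact measure_illegitimateCycle_le hR m
    _ = 8 + 10 * ∑' m, uniformProduct (ℕ × V) R (productiveCycle L c m) := by
        rw [ENNReal.tsum_mul_left, ← mul_assoc]; norm_num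
    _ ≤ 8 + 10 * T := by gcongr

theorem expectedRounds_le (hR : 2 * Fintype.card V ≤ R) (hA : A.SelfStabilizing L)
    (hs : A.Silent L) (hT : A.StabilizesInMoves L T) :
    (transform A sel R).expectedRounds (legitimate A L sel R) c ≤ 8 + 10 * T := by
  change ∫⁻ ω : ℕ × V → Fin R, (transform A sel R).stabilizationTime (legitimate A L sel R) c ω
    ∂uniformProduct (ℕ × V) R ≤ _
  exact (lintegral_mono fun ω => stabilizationTime_le_tsum hs ω).trans
    (lintegral_illegitimate_tsum_le hR hA hs hT)

/-- A finite integral forces almost sure finiteness. This is applied to the measurable majorant, so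
measurability of the stabilization time itself is not needed. -/
theorem ae_exists_run_mem_legitimate (hR : 2 * Fintype.card V ≤ R) (hA : A.SelfStabilizing L)
    (hs : A.Silent L) (hT : A.StabilizesInMoves L T) :
    ∀ᵐ ω ∂(transform A sel R).coinMeasure,
      ∃ t, (transform A sel R).run c ω t ∈ legitimate A L sel R := by
  have hfin : ∫⁻ ω, 8 + 5 * ∑' m, (illegitimateCycle L c m).indicator (1 : (ℕ × V → Fin R) → ENNReal) ω
      ∂uniformProduct (ℕ × V) R ≠ ⊤ :=
    ((lintegral_illegitimate_tsum_le hR hA hs hT).trans_lt (by finiteness)).ne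
  have h := ae_lt_top measurable_illegitimate_tsum hfin
  change ∀ᵐ ω : ℕ × V → Fin R ∂uniformProduct (ℕ × V) R,
    ∃ t, (transform A sel R).run c ω t ∈ legitimate A L sel R
  filter_upwards [h] with ω hω
  exact exists_mem_of_stabilizationTime_ne_top _
    ((stabilizationTime_le_tsum hs ω).trans_lt hω).ne

end Expectation

end TrR1W1

theorem mainTheorem4 :
    ∃ κ : NNReal, ∀ (n : ℕ) (G : SimpleGraph (Fin n)) (A : R1W1Alg G) (L : Set A.Config) (T : ℕ),
      A.SelfStabilizing L → A.Silent L → A.StabilizesInMoves L T →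
      ∀ (K n' R : ℕ) [NeZero R], 2 ≤ K → n ≤ n' → R = K * n' → ∀ sel : A.Selector,
        (TrR1W1.transform A sel R).SelfStabilizing (TrR1W1.legitimate A L sel R) ∧
        ∀ c : (TrR1W1.transform A sel R).Config,
          (TrR1W1.transform A sel R).expectedRounds (TrR1W1.legitimate A L sel R) c ≤
            κ * (max T 1 : ℕ) := by
  -- `18 = 8 + 10`, because `max T 1` dominates both `1` and `T`.
  refine ⟨18, fun n G A L T hA hs hT K n' R _ hK hn hR sel => ?_⟩
  have hR' : 2 * Fintype.card (Fin n) ≤ R := by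
    rw [Fintype.card_fin, hR]
    exact Nat.mul_le_mul hK hn
  refine ⟨⟨fun c hc a => TrR1W1.round_mem_legitimate hs sel R hc a,
    fun c => TrR1W1.ae_exists_run_mem_legitimate hR' hA hs hT⟩, fun c => ?_⟩
  refine (TrR1W1.expectedRounds_le hR' hA hs hT).trans ?_
  calc (8 + 10 * T : ENNReal) = ((8 + 10 * T : ℕ) : ENNReal) := by push_cast; rfl
    _ ≤ ((18 * max T 1 : ℕ) : ENNReal) := Nat.cast_le.2 (by omega)
    _ = _ := by push_cast; rfl
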